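/- Let $T'$ be a complete first-order theory in a countable language $L'$ (function, constant and relation symbols are allowed), and suppose that $T'$ is $\omega$-categorical, i.e. any two countably infinite models of $T'$ are isomorphic. Let $n\ge 1$ and suppose that $T'$ is $n$-ary. Let $T$ be a restriction (reduct) of $T'$ to a sublanguage $L\subseteq L'$, i.e. an $L$-sentence is a consequence of $T$ if and only if it is a consequence of $T'$. Then $T$ is almost unary-tizable, i.e. $T$ has an expansion that is almost $1$-ary. Here the following definitions are used. * Two formulas are equivalent in a theory $S$ if they have the same realizations in every model of $S$. A formula "with $n$ free variables" is one with at most $n$ free variables. * $S$ is *$n$-ary* ($n\ge 1$) if every formula of the language of $S$ is equivalent in $S$ to a Boolean combination of formulas each of which has $n$ free variables; for $n=1$, formulas $x\approx y$ with $x,y$ variables are also allowed in the Boolean combination. * An *$n$-formula* of $S$ is a formula equivalent in $S$ to a Boolean combination of formulas each of which has $n$ free variables. * $S$ is *almost $n$-ary* if there are finitely many formulas $\varphi_1(\overline x),\dots,\varphi_m(\overline x)$ such that every formula is equivalent in $S$ to a Boolean combination of $n$-formulas of $S$ and of formulas obtained from $\varphi_1,\dots,\varphi_m$ by substituting variables (not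 necessarily distinct) for the free variables. * An *expansion* of $T$ is a complete theory $T''$ in a language containing $L$ whose restriction to $L$ is $T$. -/

import Mathlib

universe u v

namespace FirstOrder.Language

variable {L : Language.{u, v}}

/-- `BooleanCombination S φ`: the formula `φ` is built from formulas of `S` by means of
falsity, negation, conjunction and disjunction. Variables are indexed by `ℕ`. -/
inductive BooleanCombination (S : Set (L.Formula ℕ)) : L.Formula ℕ → Prop
  | of (φ : L.Formula ℕ) : φ ∈ S → BooleanCombination S φ
  | falsum : BooleanCombination S ⊥
  | not (φ : L.Formula ℕ) : BooleanCombination S φ → BooleanCombination S φ.not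
  | inf (φ ψ : L.Formula ℕ) :
      BooleanCombination S φ → BooleanCombination S ψ → BooleanCombination S (φ ⊓ ψ)
  | sup (φ ψ : L.Formula ℕ) :
      BooleanCombination S φ → BooleanCombination S ψ → BooleanCombination S (φ ⊔ ψ)

/-- The formulas with (at most) `n` free variables. -/
def formulasWithFreeVars (L : Language.{u, v}) (n : ℕ) : Set (L.Formula ℕ) :=
  {φ | φ.freeVarFinset.card ≤ n}

/-- The formulas `x ≈ y`, where `x` and `y` are variables. -/
def variableEqualities (L : Language.{u, v}) : Set (L.Formula ℕ) :=
  {φ | ∃ i j : ℕ, φ = (Term.var i : L.Term ℕ).equal (Term.var j)}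

/-- The formulas obtained from members of `Φ` by substituting variables (not necessarily
distinct) for their free variables. -/
def substitutionInstances (Φ : Set (L.Formula ℕ)) : Set (L.Formula ℕ) :=
  {φ | ∃ ψ ∈ Φ, ∃ f : ℕ → ℕ, φ = Formula.relabel f ψ}

namespace Theory

/-- Every formula is `T`-equivalent to a Boolean combination of formulas from `Δ`. -/
def IsBasedOn (T : L.Theory) (Δ : Set (L.Formula ℕ)) : Prop :=
  ∀ φ : L.Formula ℕ, ∃ ψ : L.Formula ℕ, BooleanCombination Δ ψ ∧ T.Iff φ ψ

/-- The `n`-formulas of `T`: the formulas that are `T`-equivalent to a Boolean combination of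
formulas with `n` free variables. -/
def nFormulas (T : L.Theory) (n : ℕ) : Set (L.Formula ℕ) :=
  {φ | ∃ ψ : L.Formula ℕ, BooleanCombination (L.formulasWithFreeVars n) ψ ∧ T.Iff φ ψ}

/-- `T` is `n`-ary. In the unary case `n = 1` the formulas `x ≈ y` are allowed
in the Boolean combinations besides the formulas with one free variable. -/
def IsNAry (T : L.Theory) (n : ℕ) : Prop :=
  T.IsBasedOn (L.formulasWithFreeVars n ∪ {φ | n = 1 ∧ φ ∈ L.variableEqualities})

/-- `T` is almost `n`-ary: some finite set `Φ` of formulas witnesses that each formula is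
`T`-equivalent to a Boolean combination of `n`-formulas and substitution instances of
members of `Φ`. -/
def IsAlmostNAry (T : L.Theory) (n : ℕ) : Prop :=
  ∃ Φ : Set (L.Formula ℕ), Φ.Finite ∧ T.IsBasedOn (T.nFormulas n ∪ substitutionInstances Φ)

/-- `T` is the restriction of `T'` to the language `L`, which is viewed as a sublanguage of `L'`
through the injective map `ι`; equivalently, `T'` is an expansion of `T`. The theories are compared
through the sentences they entail, so neither has to be deductively closed as a set. -/
def IsRestriction {L' : Language.{u, v}} (ι : L →ᴸ L') (T : L.Theory) (T' : L'.Theory) : Prop :=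
  ι.Injective ∧ ∀ σ : L.Sentence, T ⊨ᵇ σ ↔ T' ⊨ᵇ ι.onSentence σ

/-- `T` is almost `n`-aritizable: some expansion of `T` to a complete theory is almost `n`-ary. -/
def IsAlmostNAritizable (T : L.Theory) (n : ℕ) : Prop :=
  ∃ (L'' : Language.{u, v}) (ι : L →ᴸ L'') (T'' : L''.Theory),
    T''.IsComplete ∧ IsRestriction ι T T'' ∧ T''.IsAlmostNAry n

/-- Almost unary-tizable theories. -/
def IsAlmostUnaryTizable (T : L.Theory) : Prop :=
  T.IsAlmostNAritizable 1

end Theory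

end FirstOrder.Language

/-!
The space of complete types of a theory in `ℕ`-many variables is a Baire space. The types all of
whose existential formulas are witnessed by variables form a residual set, and each of them is the
type of an enumeration of a countable model. Restricting a type to finitely many of its variables is
a continuous open map, so a generic such model realizes no type from a given meagre set: this is the
Omitting Types Theorem. If the theory is complete and `ω`-categorical, then a non-isolated type
would be omitted by one countable model and realized by another, so the compact space of types in
finitely many variables is discrete, hence finite, and there are only finitely many formulas in
these variables up to equivalence. For an `n`-ary theory, representatives of the formulas in `n`
variables together with `x₀ ≈ x₁` therefore generate all formulas by substitutions and Boolean
combinations.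
-/

namespace RyllNardzewski

open FirstOrder FirstOrder.Language FirstOrder.Language.Theory
open FirstOrder.Language.Theory.CompleteType
open Cardinal

variable {L : FirstOrder.Language.{u, v}} {T : L.Theory}

section Formulas

variable {α β : Type*}

theorem realize_congr_freeVars [DecidableEq α] {M : Type*} [L.Structure M] {φ : L.Formula α}
    {v w : α → M} (h : ∀ a ∈ φ.freeVarFinset, v a = w a) : φ.Realize v ↔ φ.Realize w :=
  (BoundedFormula.realize_restrictFreeVar (f := id) (v := fun a : φ.freeVarFinset => v a) v
    fun _ => rfl).symm.trans
    (BoundedFormula.realize_restrictFreeVar w fun a => h a a.2)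

open Classical in
/-- The formula in the variables `α` saying that the assignment to them is of the form `v ∘ f` for
some assignment `v` to the variables `β` realizing `θ`. Only the finitely many variables that occur
free in `θ` or in the range of `f` are quantified. -/
noncomputable def existsAlong [Fintype α] (f : α → β) (θ : L.Formula β) : L.Formula α :=
  Formula.iExs ↥(θ.freeVarFinset ∪ Finset.univ.image f)
    (θ.restrictFreeVar (fun b => Sum.inr ⟨b, Finset.mem_union_left _ b.2⟩) ⊓
      Formula.iInf fun a : α => (Term.var (Sum.inr ⟨f a, Finset.mem_union_right _
        (Finset.mem_image_of_mem f (Finset.mem_univ a))⟩)).equal (Term.var (Sum.inl a)))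

theorem realize_existsAlong [Fintype α] {M : Type*} [L.Structure M] [Nonempty M] {f : α → β}
    {θ : L.Formula β} {a : α → M} :
    (existsAlong f θ).Realize a ↔ ∃ v : β → M, θ.Realize v ∧ v ∘ f = a := by
  classical
  simp only [existsAlong, Formula.realize_iExs, Formula.realize_inf, Formula.realize_iInf,
    Formula.realize_equal, Term.realize_var, Sum.elim_inr, Sum.elim_inl]
  constructor
  · rintro ⟨u, hu, hua⟩
    let v : β → M := Function.extend Subtype.val u fun _ => Classical.arbitrary M
    have hv (b) : v b.1 = u b := Subtype.val_injective.extend_apply u _ b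
    exact ⟨v, (BoundedFormula.realize_restrictFreeVar v fun b => (hv _).symm).1 hu,
      funext fun k => (hv _).trans (hua k)⟩
  · rintro ⟨v, hv, rfl⟩
    refine ⟨fun b => v b, ?_, fun _ => rfl⟩
    exact Iff.mpr (BoundedFormula.realize_restrictFreeVar v fun _ => rfl) hv

end Formulas

section TypeSpace

universe w w'

variable {α : Type w} {β : Type w'}

/-- The basic clopen set of the complete types that contain the formula `φ`. It differs from
`Theory.typesWith` in that `φ` is given as a formula in the variables `α` rather than as a sentence
with constants from `α`. -/
def typesContaining (T : L.Theory) (φ : L.Formula α) : Set (T.CompleteType α) :=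
  T.typesWith (Formula.equivSentence φ)

@[simp]
theorem typeOf_mem_typesContaining {M : Type*} [L.Structure M] [Nonempty M] [M ⊨ T] {v : α → M}
    {φ : L.Formula α} : T.typeOf v ∈ typesContaining T φ ↔ φ.Realize v :=
  formula_mem_typeOf

theorem ext_typesContaining {p q : T.CompleteType α}
    (h : ∀ φ, p ∈ typesContaining T φ ↔ q ∈ typesContaining T φ) : p = q :=
  SetLike.ext (Formula.equivSentence.surjective.forall.2 h)

theorem isClopen_typesContaining (φ : L.Formula α) : IsClopen (typesContaining T φ) :=
  _root_.CompleteType.isClopen_typesWith _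

theorem isTopologicalBasis_range_typesContaining :
    TopologicalSpace.IsTopologicalBasis (Set.range (typesContaining T (α := α))) := by
  have h : Set.range (typesContaining T (α := α)) = Set.range T.typesWith :=
    Formula.equivSentence.surjective.range_comp T.typesWith
  exact h ▸ _root_.CompleteType.isTopologicalBasis_range_typesWith

theorem iff_iff_forall_realize {φ ψ : L.Formula α} :
    φ ⇔[T] ψ ↔ ∀ (M : ModelType.{u, v, max u v w} T) (v : α → M), φ.Realize v ↔ ψ.Realize v := by
  simp only [Theory.Iff, models_formula_iff, Formula.realize_iff]

theorem typesContaining_eq_iff {φ ψ : L.Formula α} :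
    typesContaining T φ = typesContaining T ψ ↔ φ ⇔[T] ψ := by
  rw [iff_iff_forall_realize]
  constructor
  · intro h M v
    rw [← typeOf_mem_typesContaining (T := T), h, typeOf_mem_typesContaining]
  · intro h
    ext p
    obtain ⟨M, v, rfl⟩ := exists_modelType_is_realized_in T p
    simpa only [typeOf_mem_typesContaining] using h M v

/-- A finite Stone space has finitely many clopen sets. -/
theorem exists_finite_formulas_of_finite_completeType [Finite (T.CompleteType α)] :
    ∃ F : Set (L.Formula α), F.Finite ∧ ∀ φ, ∃ ψ ∈ F, φ ⇔[T] ψ := by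
  refine ⟨Set.range (Set.rangeSplitting (typesContaining T)), Set.finite_range _, fun φ => ?_⟩
  let U : Set.range (typesContaining T) := ⟨typesContaining T φ, φ, rfl⟩
  exact ⟨_, ⟨U, rfl⟩, typesContaining_eq_iff.1 (Set.apply_rangeSplitting _ U).symm⟩

theorem typeOf_comp_elementaryEmbedding {M N : Type*} [L.Structure M] [L.Structure N] [Nonempty M]
    [Nonempty N] [M ⊨ T] [N ⊨ T] (f : M ↪ₑ[L] N) (v : α → M) : T.typeOf (f ∘ v) = T.typeOf v :=
  ext_typesContaining fun φ => by simp only [typeOf_mem_typesContaining, f.map_formula]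

theorem realizedTypes_subset_of_elementaryEmbedding {M N : Type*} [L.Structure M] [L.Structure N]
    [Nonempty M] [Nonempty N] [M ⊨ T] [N ⊨ T] (f : M ↪ₑ[L] N) :
    T.realizedTypes M α ⊆ T.realizedTypes N α := by
  rintro _ ⟨v, rfl⟩
  exact ⟨f ∘ v, typeOf_comp_elementaryEmbedding f v⟩

theorem dense_realizedTypes (hT : T.IsComplete) (M : Type*) [L.Structure M] [Nonempty M] [M ⊨ T] :
    Dense (T.realizedTypes M α) := by
  refine isTopologicalBasis_range_typesContaining.dense_iff.2 ?_
  rintro _ ⟨θ, rfl⟩ ⟨p, hp⟩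
  obtain ⟨N, v, rfl⟩ := exists_modelType_is_realized_in T p
  let σ : L.Sentence := existsAlong (Empty.elim : Empty → α) θ
  have hN : N ⊨ σ := realize_existsAlong.2
    ⟨v, typeOf_mem_typesContaining.1 hp, Subsingleton.elim _ _⟩
  have hM : M ⊨ σ := (hT.realize_sentence_iff σ M).2 ((hT.realize_sentence_iff σ N).1 hN)
  obtain ⟨w, hw, -⟩ := realize_existsAlong.1 hM
  exact ⟨T.typeOf w, typeOf_mem_typesContaining.2 hw, w, rfl⟩

theorem finite_completeType_of_finite_model [Finite α] (hT : T.IsComplete) (M : Type*)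
    [L.Structure M] [Nonempty M] [M ⊨ T] [Finite M] : Finite (T.CompleteType α) := by
  have hfin : (T.realizedTypes M α).Finite := Set.finite_range _
  rw [← Set.finite_univ_iff, ← (dense_realizedTypes hT M).closure_eq, hfin.isClosed.closure_eq]
  exact hfin

end TypeSpace

section Restriction

universe w w'

variable {α : Type w} {β : Type w'}

/-- The complete type in the variables `α` obtained from a complete type `q` in the variables `β`
by substitution along `f : α → β`: the type of `v ∘ f` for any `v` realizing `q`. For injective `f`
it is the restriction of `q` to the variables in the range of `f`. -/
noncomputable def comap (f : α → β) (q : T.CompleteType β) : T.CompleteType α :=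
  T.typeOf ((exists_modelType_is_realized_in T q).choose_spec.choose ∘ f)

theorem comap_mem_typesContaining {f : α → β} {q : T.CompleteType β} {φ : L.Formula α} :
    comap f q ∈ typesContaining T φ ↔ q ∈ typesContaining T (φ.relabel f) := by
  conv_rhs => rw [← (exists_modelType_is_realized_in T q).choose_spec.choose_spec]
  rw [comap, typeOf_mem_typesContaining, typeOf_mem_typesContaining, Formula.realize_relabel]

theorem comap_typeOf {M : Type*} [L.Structure M] [Nonempty M] [M ⊨ T] (f : α → β) (v : β → M) :
    comap f (T.typeOf v) = T.typeOf (v ∘ f) :=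
  ext_typesContaining fun φ => by
    rw [comap_mem_typesContaining, typeOf_mem_typesContaining, typeOf_mem_typesContaining,
      Formula.realize_relabel]

theorem continuous_comap (f : α → β) : Continuous (comap f : T.CompleteType β → _) := by
  refine isTopologicalBasis_range_typesContaining.continuous_iff.2 ?_
  rintro _ ⟨φ, rfl⟩
  have h : comap f ⁻¹' typesContaining T φ = typesContaining T (φ.relabel f) :=
    Set.ext fun _ => comap_mem_typesContaining
  exact h ▸ (isClopen_typesContaining _).isOpen

theorem image_comap_typesContaining [Fintype α] (f : α → β) (θ : L.Formula β) :
    comap f '' typesContaining T θ = typesContaining T (existsAlong f θ) := by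
  ext p
  constructor
  · rintro ⟨q, hq, rfl⟩
    obtain ⟨M, v, rfl⟩ := exists_modelType_is_realized_in T q
    rw [comap_typeOf, typeOf_mem_typesContaining]
    exact realize_existsAlong.2 ⟨v, typeOf_mem_typesContaining.1 hq, rfl⟩
  · intro hp
    obtain ⟨M, a, rfl⟩ := exists_modelType_is_realized_in T p
    obtain ⟨v, hv, rfl⟩ := realize_existsAlong.1 (typeOf_mem_typesContaining.1 hp)
    exact ⟨T.typeOf v, typeOf_mem_typesContaining.2 hv, comap_typeOf f v⟩

theorem isOpenMap_comap [Finite α] (f : α → β) : IsOpenMap (comap f : T.CompleteType β → _) := by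
  have := Fintype.ofFinite α
  refine isTopologicalBasis_range_typesContaining.isOpenMap_iff.2 ?_
  rintro _ ⟨θ, rfl⟩
  exact image_comap_typesContaining f θ ▸ (isClopen_typesContaining _).isOpen

end Restriction

section Witnessed

universe w

variable {β : Type w}

/-- The formula obtained from `φ` by substituting the variable `j` for its last variable. -/
def instantiate (φ : L.Formula (β ⊕ Fin 1)) (j : β) : L.Formula β :=
  φ.relabel (Sum.elim id fun _ => j)

theorem realize_instantiate {M : Type*} [L.Structure M] {φ : L.Formula (β ⊕ Fin 1)} {j : β}
    {v : β → M} : (instantiate φ j).Realize v ↔ φ.Realize (Sum.elim v fun _ => v j) := by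
  rw [instantiate, Formula.realize_relabel, Sum.comp_elim]
  rfl

/-- The set of the types that decide the existential formula `∃ y, φ` negatively or contain an
instance of it. -/
def witnessing (T : L.Theory) (φ : L.Formula (β ⊕ Fin 1)) : Set (T.CompleteType β) :=
  (typesContaining T (φ.iExs (Fin 1)))ᶜ ∪ ⋃ j, typesContaining T (instantiate φ j)

theorem isOpen_witnessing (φ : L.Formula (β ⊕ Fin 1)) : IsOpen (witnessing T φ) :=
  (isClopen_typesContaining _).compl.isOpen.union
    (isOpen_iUnion fun _ => (isClopen_typesContaining _).isOpen)

/-- A variable occurring neither in `φ` nor in a given basic open set can be made a witness. -/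
theorem dense_witnessing [Infinite β] (φ : L.Formula (β ⊕ Fin 1)) : Dense (witnessing T φ) := by
  classical
  refine isTopologicalBasis_range_typesContaining.dense_iff.2 ?_
  rintro _ ⟨θ, rfl⟩ ⟨q, hq⟩
  by_cases hφ : q ∈ typesContaining T (φ.iExs (Fin 1))
  swap
  · exact ⟨q, hq, Or.inl hφ⟩
  obtain ⟨M, v, rfl⟩ := exists_modelType_is_realized_in T q
  obtain ⟨x, hx⟩ := Formula.realize_iExs.1 (typeOf_mem_typesContaining.1 hφ)
  obtain ⟨j, hj⟩ := Infinite.exists_notMem_finset (θ.freeVarFinset ∪ φ.freeVarFinset.toLeft)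
  simp only [Finset.mem_union, Finset.mem_toLeft, not_or] at hj
  let w : β → M := Function.update v j (x 0)
  have hw {b : β} (hb : b ≠ j) : v b = w b := (Function.update_of_ne hb _ _).symm
  have hθ : θ.Realize w := (realize_congr_freeVars fun b hb =>
    hw (ne_of_mem_of_not_mem hb hj.1)).1 (typeOf_mem_typesContaining.1 hq)
  have hinst : (instantiate φ j).Realize w := by
    refine realize_instantiate.2 ((realize_congr_freeVars ?_).1 hx)
    rintro (b | k) hb
    · exact hw fun h => hj.2 (h ▸ hb)
    · simp [w, Subsingleton.elim k 0]
  exact ⟨T.typeOf w, typeOf_mem_typesContaining.2 hθ,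
    Or.inr (Set.mem_iUnion.2 ⟨j, typeOf_mem_typesContaining.2 hinst⟩)⟩

/-- A type is witnessed if it contains an instance of each existential formula that it contains
(the Henkin property, with variables in place of constants). -/
def IsWitnessed (q : T.CompleteType β) : Prop :=
  ∀ φ : L.Formula (β ⊕ Fin 1), q ∈ witnessing T φ

theorem eventually_residual_isWitnessed [Countable L.Symbols] [Countable β] [Infinite β] :
    ∀ᶠ q in residual (T.CompleteType β), IsWitnessed q :=
  eventually_countable_forall.2 fun φ =>
    residual_of_dense_open (isOpen_witnessing φ) (dense_witnessing φ)

theorem IsWitnessed.exists_realize {M : Type*} [L.Structure M] [Nonempty M] [M ⊨ T] {v : β → M}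
    (h : IsWitnessed (T.typeOf v)) {φ : L.Formula (β ⊕ Fin 1)} {x : Fin 1 → M}
    (hx : φ.Realize (Sum.elim v x)) : ∃ j, φ.Realize (Sum.elim v fun _ => v j) := by
  rcases h φ with hφ | hφ
  · exact absurd (typeOf_mem_typesContaining.2 (Formula.realize_iExs.2 ⟨x, hx⟩)) hφ
  · exact (Set.mem_iUnion.1 hφ).imp fun j hj =>
      realize_instantiate.1 (typeOf_mem_typesContaining.1 hj)

theorem IsWitnessed.meetsDefinable_range {M : Type*} [L.Structure M] [Nonempty M] [M ⊨ T]
    {v : β → M} (h : IsWitnessed (T.typeOf v)) : L.MeetsDefinable (Set.range v) := by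
  rintro D ⟨d, hd⟩ hD
  obtain ⟨φ, hφ⟩ := Set.definable_iff_exists_formula_sum.1 hD
  let φ' : L.Formula (β ⊕ Fin 1) := φ.relabel (Sum.map (Set.rangeSplitting v) id)
  have hφ' (x : M) : φ'.Realize (Sum.elim v fun _ => x) ↔ x ∈ D := by
    have hx : x ∈ D ↔ φ.Realize (Sum.elim Subtype.val fun _ => x) := Set.ext_iff.1 hφ fun _ => x
    rw [hx, Formula.realize_relabel, Sum.elim_comp_map, Set.comp_rangeSplitting]
    rfl
  obtain ⟨j, hj⟩ := h.exists_realize ((hφ' d).2 hd)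
  exact ⟨v j, (hφ' _).1 hj, j, rfl⟩

theorem IsWitnessed.exists_surjective_typeOf_eq {q : T.CompleteType β} (h : IsWitnessed q) :
    ∃ (N : ModelType.{u, v, max u v w} T) (v : β → N), v.Surjective ∧ T.typeOf v = q := by
  obtain ⟨M, v, rfl⟩ := exists_modelType_is_realized_in T q
  let S : L.ElementarySubstructure M := h.meetsDefinable_range.toElementarySubstructure
  have hS : (S : Set M) = Set.range v := h.meetsDefinable_range.closure_eq_self
  have := S.elementarilyEquivalent.symm.nonempty
  let v' : β → S := fun b => ⟨v b, hS.ge ⟨b, rfl⟩⟩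
  refine ⟨ModelType.of T S, v', fun x => ?_, (typeOf_comp_elementaryEmbedding S.subtype v').symm⟩
  obtain ⟨b, hb⟩ := hS.le x.2
  exact ⟨b, Subtype.ext hb⟩

end Witnessed

/-- The **Omitting Types Theorem**. -/
theorem exists_countable_model_disjoint_realizedTypes [Countable L.Symbols] (hT : T.IsSatisfiable)
    {α : Type*} [Finite α] {P : Set (T.CompleteType α)} (hP : IsMeagre P) :
    ∃ N : ModelType.{u, v, max u v} T, Countable N ∧ Disjoint P (T.realizedTypes N α) := by
  have : Nonempty (T.CompleteType ℕ) := CompleteType.nonempty_iff.2 hT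
  have hgeneric : ∀ᶠ q in residual (T.CompleteType ℕ), ∀ f : α → ℕ, comap f q ∉ P :=
    eventually_countable_forall.2 fun f =>
      tendsto_residual_of_isOpenMap (continuous_comap f) (isOpenMap_comap f) hP
  obtain ⟨q, hq, hqP⟩ :=
    (dense_of_mem_residual (eventually_residual_isWitnessed.and hgeneric)).nonempty
  obtain ⟨N, v, hv, rfl⟩ := hq.exists_surjective_typeOf_eq
  refine ⟨N, hv.countable, Set.disjoint_right.2 ?_⟩
  rintro _ ⟨a, rfl⟩
  obtain ⟨f, rfl⟩ := hv.comp_left a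
  exact comap_typeOf (T := T) f v ▸ hqP f

section Categorical

variable {α : Type}

theorem exists_model_card_eq_aleph0_realizing [Countable L.Symbols] [Countable α]
    (hinf : ∀ M : ModelType.{u, v, max u v} T, Infinite M) (p : T.CompleteType α) :
    ∃ M : ModelType.{u, v, max u v} T, #M = ℵ₀ ∧ p ∈ T.realizedTypes M α := by
  obtain ⟨M, v, rfl⟩ := exists_modelType_is_realized_in T p
  have := hinf M
  have hL : L.card ≤ ℵ₀ := mk_le_aleph0
  obtain ⟨S, hvS, hS⟩ := exists_elementarySubstructure_card_eq L (Set.range v)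
    (ℵ₀ : Cardinal.{max u v}) le_rfl (lift_le.2 (Set.countable_range v).le_aleph0)
    (by simpa using hL) (by simp)
  have := S.elementarilyEquivalent.symm.nonempty
  let v' : α → S := fun a => ⟨v a, hvS ⟨a, rfl⟩⟩
  exact ⟨ModelType.of T S, by simpa using hS, v',
    (typeOf_comp_elementaryEmbedding S.subtype v').symm⟩

theorem isOpen_singleton_of_categorical [Countable L.Symbols] [Finite α]
    (hcat : Cardinal.aleph0.{max u v}.Categorical T)
    (hinf : ∀ M : ModelType.{u, v, max u v} T, Infinite M) (p : T.CompleteType α) :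
    IsOpen {p} := by
  by_contra hp
  have hmeagre : IsMeagre {p} :=
    residual_of_dense_open isOpen_compl_singleton (dense_compl_singleton_iff_not_open.2 hp)
  obtain ⟨N, _, hpN⟩ := exists_countable_model_disjoint_realizedTypes
    (CompleteType.nonempty_iff.1 ⟨p⟩) hmeagre
  obtain ⟨M, hM, hpM⟩ := exists_model_card_eq_aleph0_realizing hinf p
  have := hinf N
  obtain ⟨e⟩ := hcat M N hM (mk_eq_aleph0 N)
  exact Set.disjoint_singleton_left.1 hpN
    (realizedTypes_subset_of_elementaryEmbedding e.toElementaryEmbedding hpM)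

/-- The **Ryll-Nardzewski Theorem**. -/
theorem finite_completeType_of_categorical [Countable L.Symbols] [Finite α] (hT : T.IsComplete)
    (hcat : Cardinal.aleph0.{max u v}.Categorical T) : Finite (T.CompleteType α) := by
  obtain ⟨M⟩ := hT.1
  rcases finite_or_infinite M with _ | _
  · exact finite_completeType_of_finite_model hT M
  · have hinf (N : ModelType.{u, v, max u v} T) : Infinite N :=
      (hT.models_elementarily_equivalent M N).infinite
    have : DiscreteTopology (T.CompleteType α) :=
      discreteTopology_iff_isOpen_singleton.2 (isOpen_singleton_of_categorical hcat hinf)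
    exact finite_of_compact_of_discrete

end Categorical

section Arity

theorem exists_booleanCombination_iff {Δ Δ' : Set (L.Formula ℕ)}
    (h : ∀ φ ∈ Δ, ∃ ψ ∈ Δ', φ ⇔[T] ψ) {φ : L.Formula ℕ} (hφ : BooleanCombination Δ φ) :
    ∃ ψ, BooleanCombination Δ' ψ ∧ φ ⇔[T] ψ := by
  induction hφ with
  | of φ hφ => exact (h φ hφ).imp fun ψ hψ => ⟨.of ψ hψ.1, hψ.2⟩
  | falsum => exact ⟨⊥, .falsum, Theory.Iff.refl _⟩
  | not φ _ ih =>
    obtain ⟨ψ, hψ, hiff⟩ := ih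
    exact ⟨ψ.not, .not ψ hψ, hiff.not⟩
  | inf φ₁ φ₂ _ _ ih₁ ih₂ =>
    obtain ⟨ψ₁, hψ₁, hiff₁⟩ := ih₁
    obtain ⟨ψ₂, hψ₂, hiff₂⟩ := ih₂
    rw [iff_iff_forall_realize] at hiff₁ hiff₂
    exact ⟨ψ₁ ⊓ ψ₂, .inf _ _ hψ₁ hψ₂, iff_iff_forall_realize.2 fun M v => by
      rw [Formula.realize_inf, Formula.realize_inf, hiff₁, hiff₂]⟩
  | sup φ₁ φ₂ _ _ ih₁ ih₂ =>
    obtain ⟨ψ₁, hψ₁, hiff₁⟩ := ih₁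
    obtain ⟨ψ₂, hψ₂, hiff₂⟩ := ih₂
    rw [iff_iff_forall_realize] at hiff₁ hiff₂
    exact ⟨ψ₁ ⊔ ψ₂, .sup _ _ hψ₁ hψ₂, iff_iff_forall_realize.2 fun M v => by
      rw [Formula.realize_sup, Formula.realize_sup, hiff₁, hiff₂]⟩

theorem isBasedOn_of_forall_exists_iff {Δ Δ' : Set (L.Formula ℕ)} (hT : T.IsBasedOn Δ)
    (h : ∀ φ ∈ Δ, ∃ ψ ∈ Δ', φ ⇔[T] ψ) : T.IsBasedOn Δ' := by
  intro φ
  obtain ⟨ψ, hψ, hφψ⟩ := hT φ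
  obtain ⟨χ, hχ, hψχ⟩ := exists_booleanCombination_iff h hψ
  exact ⟨χ, hχ, hφψ.trans hψχ⟩

theorem exists_iff_relabel_of_card_freeVarFinset_le {α : Type*} [DecidableEq α] [Nonempty α] {n : ℕ}
    {φ : L.Formula α} (hφ : φ.freeVarFinset.card ≤ n) :
    ∃ (ψ : L.Formula (Fin n)) (g : Fin n → α), φ ⇔[T] ψ.relabel g := by
  let f : φ.freeVarFinset → Fin n := Fin.castLE hφ ∘ φ.freeVarFinset.equivFin
  have hf : f.Injective := (Fin.castLE_injective hφ).comp φ.freeVarFinset.equivFin.injective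
  let g : Fin n → α := Function.extend f Subtype.val fun _ => Classical.arbitrary α
  refine ⟨φ.restrictFreeVar f, g, iff_iff_forall_realize.2 fun M v => ?_⟩
  rw [Formula.realize_relabel]
  exact (BoundedFormula.realize_restrictFreeVar v fun a => by simp [g, hf.extend_apply]).symm

theorem exists_iff_mem_substitutionInstances {n : ℕ} {F : Set (L.Formula (Fin n))}
    (hF : ∀ φ, ∃ ψ ∈ F, φ ⇔[T] ψ) {φ : L.Formula ℕ} (hφ : φ ∈ L.formulasWithFreeVars n) :
    ∃ ψ ∈ substitutionInstances (Formula.relabel Fin.val '' F), φ ⇔[T] ψ := by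
  obtain ⟨χ, g, hχ⟩ := exists_iff_relabel_of_card_freeVarFinset_le (T := T) hφ
  obtain ⟨δ, hδF, hδ⟩ := hF χ
  let f : ℕ → ℕ := Function.extend Fin.val g 0
  have hfg : f ∘ Fin.val = g := Function.extend_comp Fin.val_injective g 0
  refine ⟨(δ.relabel Fin.val).relabel f, ⟨_, ⟨δ, hδF, rfl⟩, f, rfl⟩, ?_⟩
  rw [iff_iff_forall_realize] at hχ hδ ⊢
  intro M v
  simp only [hχ, hδ, Formula.realize_relabel, Function.comp_assoc, hfg]

theorem exists_iff_mem_substitutionInstances_equal {φ : L.Formula ℕ}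
    (hφ : φ ∈ L.variableEqualities) :
    ∃ ψ ∈ substitutionInstances {(Term.var 0 : L.Term ℕ).equal (Term.var 1)}, φ ⇔[T] ψ := by
  obtain ⟨i, j, rfl⟩ := hφ
  refine ⟨_, ⟨_, rfl, fun k => if k = 0 then i else j, rfl⟩, iff_iff_forall_realize.2 fun M v => ?_⟩
  simp [Formula.realize_relabel, Formula.realize_equal]

theorem isAlmostNAry_of_isNAry_of_finite_completeType {n : ℕ} [Finite (T.CompleteType (Fin n))]
    (h : T.IsNAry n) (m : ℕ) : T.IsAlmostNAry m := by
  obtain ⟨F, hF, hFT⟩ := exists_finite_formulas_of_finite_completeType (T := T) (α := Fin n)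
  refine ⟨Formula.relabel Fin.val '' F ∪ {(Term.var 0).equal (Term.var 1)},
    (hF.image _).union (Set.finite_singleton _), isBasedOn_of_forall_exists_iff h fun φ hφ => ?_⟩
  rcases hφ with hφ | ⟨-, hφ⟩
  · obtain ⟨ψ, ⟨δ, hδ, hψ⟩, hiff⟩ := exists_iff_mem_substitutionInstances hFT hφ
    exact ⟨ψ, Or.inr ⟨δ, Or.inl hδ, hψ⟩, hiff⟩
  · obtain ⟨ψ, ⟨δ, hδ, hψ⟩, hiff⟩ := exists_iff_mem_substitutionInstances_equal (T := T) hφ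
    exact ⟨ψ, Or.inr ⟨δ, Or.inr hδ, hψ⟩, hiff⟩

end Arity

end RyllNardzewski

theorem mainTheorem10 {L L' : FirstOrder.Language.{u, v}} (ι : FirstOrder.Language.LHom L L')
    (T : L.Theory) (T' : L'.Theory) (n : ℕ) (hn : 1 ≤ n)
    (hcountable : L'.card ≤ Cardinal.aleph0) (hcomplete : T'.IsComplete)
    (hcategorical : Cardinal.aleph0.{max u v}.Categorical T')
    (hnary : T'.IsNAry n) (hrestriction : FirstOrder.Language.Theory.IsRestriction ι T T') :
    T.IsAlmostUnaryTizable := by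
  have : Countable L'.Symbols := Cardinal.mk_le_aleph0_iff.1 hcountable
  have : Finite (T'.CompleteType (Fin n)) :=
    RyllNardzewski.finite_completeType_of_categorical hcomplete hcategorical
  exact ⟨L', ι, T', hcomplete, hrestriction,
    RyllNardzewski.isAlmostNAry_of_isNAry_of_finite_completeType hnary 1⟩
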